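/- Let $I\subseteq\mathbb{R}$ be a nonempty open interval, let $f:I\to\mathbb{R}$ be strictly monotone and continuous, and let $p:I\to(0,\infty)$ be an arbitrary positive function. The Bajraktarević mean $\mathscr{B}_{f,p}:\bigcup_{n\ge1}I^n\to I$ is defined by $$\mathscr{B}_{f,p}(x_1,\dots,x_n):=f^{-1}\left(\frac{p(x_1)f(x_1)+\cdots+p(x_n)f(x_n)}{p(x_1)+\cdots+p(x_n)}\right);$$ it is called Jensen convex if $\mathscr{B}_{f,p}\big(\frac{x+y}{2}\big)\le\frac12\big(\mathscr{B}_{f,p}(x)+\mathscr{B}_{f,p}(y)\big)$ for all $n\ge1$ and all $x,y\in I^n$. Let $\mathcal{C}^k(I)$ denote the set of $k$ times continuously differentiable real functions on $I$, and let $\mathcal{C}^{k\#}(I)$ denote the set of those functions in $\mathcal{C}^k(I)$ whose first derivative vanishes nowhere on $I$. Then the following conditions are equivalent to each other: (i) The Bajraktarević mean $\mathscr{B}_{f,p}$ is Jensen convex. (ii) $f\in\mathcal{C}^{1\#}(I)$ and the function $B_{f,p}:I^2\to\mathbb{R}$, $B_{f,p}(x,u):=\dfrac{p(x)(f(x)-f(u))}{p(u)f'(u)}$,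 is convex on $I^2$. (iii) $f\in\mathcal{C}^{2\#}(I)$, $p\in\mathcal{C}^1(I)$, and for all $x,y,u,v\in I$, $$\frac{p(y)(f(y)-f(v))}{p(v)f'(v)}\ge\frac{p(x)(f(x)-f(u))}{p(u)f'(u)}+\frac{(pf)'(x)-f(u)p'(x)}{(pf')(u)}(y-x)+p(x)\frac{(f(u)-f(x))(pf')'(u)-(pf')(u)f'(u)}{(pf')(u)^2}(v-u).$$ (iv) $f\in\mathcal{C}^{2\#}(I)$, $p\in\mathcal{C}^1(I)$, and for all $x,y,u,v\in I$, $$\bigg(\frac{(pf)'(x)-f(u)p'(x)}{(pf')(u)}-\frac{(pf)'(y)-f(v)p'(y)}{(pf')(v)}\bigg)(x-y)$$ $$+\bigg(p(x)\frac{(f(u)-f(x))(pf')'(u)-(pf')(u)f'(u)}{(pf')(u)^2}-p(y)\frac{(f(v)-f(y))(pf')'(v)-(pf')(v)f'(v)}{(pf')(v)^2}\bigg)(u-v)\ge0.$$ -/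

import Mathlib

/-- The `n`-variable Bajraktarević mean of the point `x` of `I ^ n`: the inverse of `f`
(as a function on `I`) at the `p`-weighted arithmetic mean of the values `f (x i)`.
If `f` is continuous and strictly monotone on the interval `I`, `p` is positive on `I` and `0 < n`,
that weighted mean lies in `f '' I`. -/
noncomputable def bajraktarevicMean (I : Set ℝ) (f p : ℝ → ℝ) (n : ℕ) (x : Fin n → ℝ) : ℝ :=
  Function.invFunOn f I ((∑ i, p (x i) * f (x i)) / ∑ i, p (x i))

/-- A mean `M`, given by its `n`-variable restrictions to `I ^ n` for `n ≥ 1`, is Jensen convex. -/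
def IsJensenConvexMean (I : Set ℝ) (M : (n : ℕ) → (Fin n → ℝ) → ℝ) : Prop :=
  ∀ n : ℕ, 1 ≤ n → ∀ x y : Fin n → ℝ, (∀ i, x i ∈ I) → (∀ i, y i ∈ I) →
    M n (fun i => (x i + y i) / 2) ≤ (M n x + M n y) / 2

/-- The class `C^{k#}(I)` on an open interval `I` (for `k ≥ 1`): the `k` times continuously
differentiable functions on `I` whose first derivative does not vanish on `I`. -/
def IsCSharp (k : ℕ) (I : Set ℝ) (f : ℝ → ℝ) : Prop :=
  ContDiffOn ℝ k f I ∧ ∀ x ∈ I, deriv f x ≠ 0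

/-- The two-variable map `B_{f,p}(x,u) = p(x) (f(x) - f(u)) / (p(u) f'(u))`. -/
noncomputable def bajraktarevicMap (f p : ℝ → ℝ) (x u : ℝ) : ℝ :=
  p x * (f x - f u) / (p u * deriv f u)

open Set Filter Topology

/-! After replacing `f` by `-f` if needed, `f` is increasing. Write D(x,u) = p(x)(f(x) - f(u)), so
that B(x,u) = D(x,u)/(p(u)f'(u)), and the mean of a tuple is at most u exactly when its deviations
D(·,u) have nonpositive sum.

The hard direction is (i) → (ii), where nothing is assumed about `p` beyond positivity. Repeating
entries and approximating weights turns Jensen convexity into a statement on convex combinations of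
the triples (D(a,u), D(b,v), D((a+b)/2,(u+v)/2)): their hull misses an open octant. Hahn–Banach
separation (`HasMeanIneq.exists_weights`) then gives α, β ≥ 0, depending only on u and v, with
D((a+b)/2,(u+v)/2) ≤ αD(a,u) + βD(b,v). The case u = v makes D(·,u) convex, hence `p` continuous.
Lebesgue's theorem gives one point where `f` is differentiable near any prescribed place, and the
inequality carries differentiability over to all points (`HasMeanIneq.exists_hasDerivAt`). Contact
at a = u, b = v identifies α and β, and the inequality becomes midpoint convexity of B.

Conversely, summing the convexity inequality of B over the entries gives the mean inequality.
Convexity of B in each variable alone already forces `f` to be C² and `p` to be C¹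
(`StrictMonoOn.regularity_of_convexOn`); (iii) and (iv) are then the tangent plane and monotone
gradient criteria for B. -/

/-! ### Convex functions: Bernstein–Doetsch, regularity, one-sided derivatives -/

/-- A midpoint convex function on `[0, 1]` that is bounded above lies below its chord. -/
theorem le_chord_of_midpoint_le {h : ℝ → ℝ} {M : ℝ} (hM : ∀ t ∈ Icc (0 : ℝ) 1, h t ≤ M)
    (hmid : ∀ s ∈ Icc (0 : ℝ) 1, ∀ t ∈ Icc (0 : ℝ) 1, h ((s + t) / 2) ≤ (h s + h t) / 2)
    {t : ℝ} (ht : t ∈ Icc (0 : ℝ) 1) : h t ≤ (1 - t) * h 0 + t * h 1 := by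
  set g : ℝ → ℝ := fun t => h t - ((1 - t) * h 0 + t * h 1) with hg
  have h0 : (0 : ℝ) ∈ Icc (0 : ℝ) 1 := by simp
  have h1 : (1 : ℝ) ∈ Icc (0 : ℝ) 1 := by simp
  have hbdd : BddAbove (g '' Icc 0 1) := by
    refine ⟨M + |h 0| + |h 1|, ?_⟩
    rintro _ ⟨s, hs, rfl⟩
    have h1' : |(1 - s) * h 0| ≤ |h 0| := by
      rw [abs_mul, abs_of_nonneg (by linarith [hs.2])]
      exact mul_le_of_le_one_left (abs_nonneg _) (by linarith [hs.1])
    have h2' : |s * h 1| ≤ |h 1| := by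
      rw [abs_mul, abs_of_nonneg hs.1]
      exact mul_le_of_le_one_left (abs_nonneg _) hs.2
    simp only [hg]
    linarith [hM s hs, neg_abs_le ((1 - s) * h 0), neg_abs_le (s * h 1)]
  have hle : ∀ s ∈ Icc (0 : ℝ) 1, g s ≤ sSup (g '' Icc 0 1) := fun s hs =>
    le_csSup hbdd (mem_image_of_mem g hs)
  -- `g` vanishes at 0 and 1, and every `s` is the midpoint of an endpoint and another point of the
  -- interval. Hence the supremum is at most half of itself.
  have hhalf : ∀ s ∈ Icc (0 : ℝ) 1, g s ≤ sSup (g '' Icc 0 1) / 2 := by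
    intro s hs
    rcases le_total s (1 / 2) with hs' | hs'
    · have h2 : 2 * s ∈ Icc (0 : ℝ) 1 := ⟨by linarith [hs.1], by linarith⟩
      have := hmid 0 h0 (2 * s) h2
      rw [show (0 + 2 * s) / 2 = s by ring] at this
      have h3 := hle _ h2
      simp only [hg] at h3 ⊢
      linarith
    · have h2 : 2 * s - 1 ∈ Icc (0 : ℝ) 1 := ⟨by linarith, by linarith [hs.2]⟩
      have := hmid 1 h1 (2 * s - 1) h2
      rw [show (1 + (2 * s - 1)) / 2 = s by ring] at this
      have h3 := hle _ h2
      simp only [hg] at h3 ⊢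
      linarith
  have hsup : sSup (g '' Icc 0 1) ≤ sSup (g '' Icc 0 1) / 2 :=
    csSup_le ⟨_, mem_image_of_mem g h0⟩ (by rintro _ ⟨s, hs, rfl⟩; exact hhalf s hs)
  have := hle t ht
  simp only [hg] at this hsup
  linarith

/-- **Bernstein–Doetsch**: a midpoint convex function that is bounded above on segments
is convex. -/
theorem convexOn_of_midpoint_le {E : Type*} [AddCommGroup E] [Module ℝ E] {S : Set E} {h : E → ℝ}
    (hS : Convex ℝ S)
    (hmid : ∀ x ∈ S, ∀ y ∈ S, h ((1 / 2 : ℝ) • (x + y)) ≤ (h x + h y) / 2)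
    (hbdd : ∀ x ∈ S, ∀ y ∈ S, ∃ M, ∀ t ∈ Icc (0 : ℝ) 1, h ((1 - t) • x + t • y) ≤ M) :
    ConvexOn ℝ S h := by
  refine ⟨hS, fun x hx y hy a b ha hb hab => ?_⟩
  obtain ⟨M, hM⟩ := hbdd x hx y hy
  have hmem : ∀ t ∈ Icc (0 : ℝ) 1, (1 - t) • x + t • y ∈ S := fun t ht =>
    hS hx hy (by linarith [ht.2]) ht.1 (by ring)
  have := le_chord_of_midpoint_le (h := fun t => h ((1 - t) • x + t • y)) hM
    (fun s hs t ht => by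
      have := hmid _ (hmem s hs) _ (hmem t ht)
      convert this using 2
      module) (t := b) ⟨hb, by linarith⟩
  obtain rfl : a = 1 - b := by linarith
  simpa using this

/-- The derivative of a differentiable convex function on an open interval is continuous. -/
theorem ConvexOn.continuousOn_deriv {I : Set ℝ} {h : ℝ → ℝ} (hI : IsOpen I)
    (hh : ConvexOn ℝ I h) (hd : ∀ x ∈ I, DifferentiableAt ℝ h x) : ContinuousOn (deriv h) I := by
  have hmono := hh.monotoneOn_deriv hd
  -- Darboux: derivatives have the intermediate value property, so a monotone one cannot jump.
  have hord : ∀ a ∈ I, ∀ b ∈ I, ∀ m ∈ Icc (deriv h a) (deriv h b), ∃ c ∈ I, deriv h c = m := by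
    intro a ha b hb m hm
    exact (hh.1.ordConnected.image_deriv hd).out (mem_image_of_mem _ ha) (mem_image_of_mem _ hb) hm
  intro a ha
  refine ContinuousAt.continuousWithinAt ?_
  obtain ⟨l, r, hlr, hsub⟩ := (mem_nhds_iff_exists_Ioo_subset).1 (hI.mem_nhds ha)
  refine tendsto_order.2 ⟨fun m hm => ?_, fun m hm => ?_⟩
  · obtain ⟨c, hc, hca, hmc⟩ : ∃ c ∈ I, c < a ∧ m < deriv h c := by
      obtain ⟨c, hc⟩ := exists_between hlr.1
      have hcI : c ∈ I := hsub ⟨hc.1, hc.2.trans hlr.2⟩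
      by_cases hmc : m < deriv h c
      · exact ⟨c, hcI, hc.2, hmc⟩
      · obtain ⟨d, hd1, hd2⟩ := hord c hcI a ha ((m + deriv h a) / 2)
          ⟨by linarith, by linarith⟩
        refine ⟨d, hd1, ?_, by linarith⟩
        by_contra! hcon
        linarith [hmono ha hd1 hcon]
    filter_upwards [Ioi_mem_nhds hca, hI.mem_nhds ha] with y hy hyI
    exact hmc.trans_le (hmono hc hyI (le_of_lt hy))
  · obtain ⟨c, hc, hca, hmc⟩ : ∃ c ∈ I, a < c ∧ deriv h c < m := by
      obtain ⟨c, hc⟩ := exists_between hlr.2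
      have hcI : c ∈ I := hsub ⟨hlr.1.trans hc.1, hc.2⟩
      by_cases hmc : deriv h c < m
      · exact ⟨c, hcI, hc.1, hmc⟩
      · obtain ⟨d, hd1, hd2⟩ := hord a ha c hcI ((m + deriv h a) / 2)
          ⟨by linarith, by linarith⟩
        refine ⟨d, hd1, ?_, by linarith⟩
        by_contra! hcon
        linarith [hmono hd1 ha hcon]
    filter_upwards [Iio_mem_nhds hca, hI.mem_nhds ha] with y hy hyI
    exact (hmono hyI hc (le_of_lt hy)).trans_lt hmc

theorem hasDerivAt_of_left_right {h : ℝ → ℝ} {d x : ℝ} (hl : HasDerivWithinAt h d (Iio x) x)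
    (hr : HasDerivWithinAt h d (Ioi x) x) : HasDerivAt h d x := by
  have := hl.union hr
  rw [Iio_union_Ioi] at this
  rw [← hasDerivWithinAt_univ]
  rw [← hasDerivWithinAt_sdiff_singleton]
  simpa [compl_eq_univ_sdiff] using this

theorem contDiffOn_one_of_deriv {I : Set ℝ} {h : ℝ → ℝ} (hI : IsOpen I)
    (hd : ∀ x ∈ I, DifferentiableAt ℝ h x) (hc : ContinuousOn (deriv h) I) :
    ContDiffOn ℝ 1 h I := by
  rw [show (1 : WithTop ℕ∞) = 0 + 1 by simp, contDiffOn_succ_iff_deriv_of_isOpen hI]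
  exact ⟨fun x hx => (hd x hx).differentiableWithinAt, by simp, contDiffOn_zero.2 hc⟩

theorem ConvexOn.contDiffOn_one {I : Set ℝ} {h : ℝ → ℝ} (hI : IsOpen I)
    (hh : ConvexOn ℝ I h) (hd : ∀ x ∈ I, DifferentiableAt ℝ h x) : ContDiffOn ℝ 1 h I :=
  contDiffOn_one_of_deriv hI hd (hh.continuousOn_deriv hI hd)

/-- If `h ≤ k` to the right of `a`, with equality at `a`, then the right derivatives compare. -/
theorem right_deriv_le_of_le {h k : ℝ → ℝ} {c d a : ℝ} (hh : HasDerivWithinAt h c (Ioi a) a)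
    (hk : HasDerivWithinAt k d (Ioi a) a) (heq : h a = k a) (hle : ∀ᶠ x in 𝓝[>] a, h x ≤ k x) :
    c ≤ d := by
  rw [hasDerivWithinAt_iff_tendsto_slope' (by simp)] at hh hk
  refine le_of_tendsto_of_tendsto hh hk ?_
  filter_upwards [hle, self_mem_nhdsWithin] with x hx hxa
  rw [slope_def_field, slope_def_field, heq]
  exact div_le_div_of_nonneg_right (by linarith) (by linarith [mem_Ioi.1 hxa])

/-- If `h ≤ k` to the left of `a`, with equality at `a`, then the left derivatives compare. -/
theorem left_deriv_le_of_le {h k : ℝ → ℝ} {c d a : ℝ} (hh : HasDerivWithinAt h c (Iio a) a)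
    (hk : HasDerivWithinAt k d (Iio a) a) (heq : h a = k a) (hle : ∀ᶠ x in 𝓝[<] a, h x ≤ k x) :
    d ≤ c := by
  rw [hasDerivWithinAt_iff_tendsto_slope' (by simp)] at hh hk
  refine le_of_tendsto_of_tendsto hk hh ?_
  filter_upwards [hle, self_mem_nhdsWithin] with x hx hxa
  rw [slope_def_field, slope_def_field, heq]
  exact div_le_div_of_nonpos_of_le (by linarith [mem_Iio.1 hxa]) (by linarith)

/-! ### First-order criteria for convexity in two variables -/

/-- `φ` restricted to the segment from `(x, u)` to `(y, v)` has the derivative given by the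
partial derivatives `φ₁`, `φ₂`. -/
def HasPartialsOn (I : Set ℝ) (φ φ₁ φ₂ : ℝ → ℝ → ℝ) : Prop :=
  ∀ x ∈ I, ∀ y ∈ I, ∀ u ∈ I, ∀ v ∈ I, ∀ t ∈ Icc (0 : ℝ) 1,
    HasDerivAt (fun t => φ (x + t * (y - x)) (u + t * (v - u)))
      (φ₁ (x + t * (y - x)) (u + t * (v - u)) * (y - x)
        + φ₂ (x + t * (y - x)) (u + t * (v - u)) * (v - u)) t

theorem add_mul_sub_mem {I : Set ℝ} (hI : Convex ℝ I) {x y t : ℝ} (hx : x ∈ I) (hy : y ∈ I)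
    (ht : t ∈ Icc (0 : ℝ) 1) : x + t * (y - x) ∈ I := by
  have := hI hx hy (by linarith [ht.2] : 0 ≤ 1 - t) ht.1 (by ring)
  convert this using 1
  simp only [smul_eq_mul]; ring

/-- Along a segment the function lies below its chord and meets it at `t = 0`, so its right
derivative there is at most the slope of the chord. -/
theorem HasPartialsOn.gradient_le {I : Set ℝ} {φ φ₁ φ₂ : ℝ → ℝ → ℝ}
    (h : HasPartialsOn I φ φ₁ φ₂) (hc : ConvexOn ℝ (I ×ˢ I) (fun z : ℝ × ℝ => φ z.1 z.2))
    {x y u v : ℝ} (hx : x ∈ I) (hy : y ∈ I) (hu : u ∈ I) (hv : v ∈ I) :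
    φ x u + φ₁ x u * (y - x) + φ₂ x u * (v - u) ≤ φ y v := by
  have hd := (h x hx y hy u hu v hv 0 (by simp)).hasDerivWithinAt (s := Ioi 0)
  have hk : HasDerivWithinAt (fun t : ℝ => φ x u + t * (φ y v - φ x u)) (φ y v - φ x u)
      (Ioi 0) 0 := by
    simpa using (((hasDerivAt_id (0 : ℝ)).mul_const (φ y v - φ x u)).const_add
      (φ x u)).hasDerivWithinAt
  have := right_deriv_le_of_le hd hk (by simp) (by
    filter_upwards [Ioo_mem_nhdsGT (zero_lt_one (α := ℝ))] with t ht
    have := hc.2 (x := (x, u)) ⟨hx, hu⟩ (y := (y, v)) ⟨hy, hv⟩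
      (by linarith [ht.2] : 0 ≤ 1 - t) ht.1.le (by ring)
    simp only [Prod.smul_mk, Prod.mk_add_mk, smul_eq_mul] at this
    rw [show x + t * (y - x) = (1 - t) * x + t * y by ring,
      show u + t * (v - u) = (1 - t) * u + t * v by ring]
    linarith)
  simp only [zero_mul, add_zero] at this
  linarith

/-- At times `s < t` on a segment, the monotonicity hypothesis is `t - s` times the increment of the
derivative of the restriction, which is therefore monotone. -/
theorem HasPartialsOn.convexOn {I : Set ℝ} (hI : Convex ℝ I) {φ φ₁ φ₂ : ℝ → ℝ → ℝ}
    (h : HasPartialsOn I φ φ₁ φ₂)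
    (hmono : ∀ x ∈ I, ∀ y ∈ I, ∀ u ∈ I, ∀ v ∈ I,
      0 ≤ (φ₁ x u - φ₁ y v) * (x - y) + (φ₂ x u - φ₂ y v) * (u - v)) :
    ConvexOn ℝ (I ×ˢ I) (fun z : ℝ × ℝ => φ z.1 z.2) := by
  refine ⟨hI.prod hI, ?_⟩
  rintro ⟨x, u⟩ ⟨hx, hu⟩ ⟨y, v⟩ ⟨hy, hv⟩ a b ha hb hab
  have hd := h x hx y hy u hu v hv
  have hconv : ConvexOn ℝ (Icc 0 1) (fun t => φ (x + t * (y - x)) (u + t * (v - u))) := by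
    refine MonotoneOn.convexOn_of_deriv (convex_Icc 0 1)
      (fun t ht => (hd t ht).continuousAt.continuousWithinAt)
      (fun t ht => (hd t (interior_subset ht)).differentiableAt.differentiableWithinAt) ?_
    intro s hs t ht hst
    have hs' := interior_subset hs
    have ht' := interior_subset ht
    rw [(hd s hs').deriv, (hd t ht').deriv]
    rcases hst.eq_or_lt with rfl | hst
    · rfl
    have := hmono _ (add_mul_sub_mem hI hx hy ht') _ (add_mul_sub_mem hI hx hy hs')
      _ (add_mul_sub_mem hI hu hv ht') _ (add_mul_sub_mem hI hu hv hs')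
    refine le_of_sub_nonneg (nonneg_of_mul_nonneg_right (b := _) (a := t - s) ?_ (sub_pos.2 hst))
    refine this.trans_eq ?_
    ring
  have := hconv.2 (x := 0) (by simp) (y := 1) (by simp) ha hb hab
  obtain rfl : a = 1 - b := by linarith
  simp only [smul_eq_mul, mul_zero, zero_add, mul_one, zero_mul, add_zero, one_mul,
    add_sub_cancel] at this
  simp only [Prod.smul_mk, Prod.mk_add_mk, smul_eq_mul]
  rw [show x + b * (y - x) = (1 - b) * x + b * y by ring,
      show u + b * (v - u) = (1 - b) * u + b * v by ring] at this
  exact this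

theorem ContDiffOn.hasDerivAt_of_isOpen {I : Set ℝ} (hI : IsOpen I) {g : ℝ → ℝ} {n : WithTop ℕ∞}
    (hg : ContDiffOn ℝ n g I) (hn : n ≠ 0) {x : ℝ} (hx : x ∈ I) :
    HasDerivAt g (deriv g x) x :=
  ((hg.differentiableOn hn x hx).differentiableAt (hI.mem_nhds hx)).hasDerivAt

theorem hasPartialsOn_bajraktarevicMap {I : Set ℝ} (hI : IsOpen I) (hc : Convex ℝ I)
    {f p : ℝ → ℝ} (hp_pos : ∀ x ∈ I, 0 < p x) (hf : IsCSharp 2 I f) (hp : ContDiffOn ℝ 1 p I) :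
    HasPartialsOn I (bajraktarevicMap f p)
      (fun x u => (deriv (fun t => p t * f t) x - f u * deriv p x) / (p u * deriv f u))
      (fun x u => p x * (((f u - f x) * deriv (fun t => p t * deriv f t) u
                - (p u * deriv f u) * deriv f u) / (p u * deriv f u) ^ 2)) := by
  intro x hx y hy u hu v hv t ht
  have hX := add_mul_sub_mem hc hx hy ht
  have hU := add_mul_sub_mem hc hu hv ht
  have hlin : ∀ x y : ℝ, HasDerivAt (fun t => x + t * (y - x)) (y - x) t := fun x y => by
    simpa using ((hasDerivAt_id t).mul_const (y - x)).const_add x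
  have hdf : ∀ x ∈ I, HasDerivAt f (deriv f x) x := fun x hx =>
    hf.1.hasDerivAt_of_isOpen hI (by simp) hx
  have hdp : ∀ x ∈ I, HasDerivAt p (deriv p x) x := fun x hx =>
    hp.hasDerivAt_of_isOpen hI (by simp) hx
  have hf' : ContDiffOn ℝ 1 (deriv f) I := by
    have := hf.1
    rw [show ((2 : ℕ) : WithTop ℕ∞) = 1 + 1 by norm_num,
      contDiffOn_succ_iff_deriv_of_isOpen hI] at this
    exact this.2.2
  have hdg : ∀ x ∈ I, HasDerivAt (fun t => p t * deriv f t)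
      (deriv (fun t => p t * deriv f t) x) x := fun x hx =>
    (hp.mul hf').hasDerivAt_of_isOpen hI (by simp) hx
  have hpf : deriv (fun t => p t * f t) (x + t * (y - x)) = _ :=
    ((hdp _ hX).mul (hdf _ hX)).deriv
  have h1 := (hdp _ hX).comp t (hlin x y)
  have h2 := (hdf _ hX).comp t (hlin x y)
  have h3 := (hdf _ hU).comp t (hlin u v)
  have h4 := (hdg _ hU).comp t (hlin u v)
  have hne : p (u + t * (v - u)) * deriv f (u + t * (v - u)) ≠ 0 :=
    mul_ne_zero (hp_pos _ hU).ne' (hf.2 _ hU)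
  have := (h1.mul (h2.sub h3)).div h4 hne
  refine this.congr_deriv ?_
  simp only [Function.comp, Pi.sub_apply, Pi.mul_apply, hpf]
  field_simp
  ring

/-! ### Change of sign of `f`, and regularity forced by convexity -/

theorem bajraktarevicMap_neg (f p : ℝ → ℝ) : bajraktarevicMap (-f) p = bajraktarevicMap f p := by
  ext x u
  simp only [bajraktarevicMap, Pi.neg_apply, deriv.neg']
  rw [show p x * (-f x - -f u) = -(p x * (f x - f u)) by ring, mul_neg, neg_div_neg_eq]

theorem IsCSharp.neg {k : ℕ} {I : Set ℝ} {f : ℝ → ℝ} (h : IsCSharp k I f) : IsCSharp k I (-f) :=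
  ⟨h.1.neg, fun x hx => by simpa [deriv.neg] using h.2 x hx⟩

theorem deriv_nonneg_of_strictMonoOn {I : Set ℝ} (hI : IsOpen I) {f : ℝ → ℝ}
    (hf : StrictMonoOn f I) {x : ℝ} (hx : x ∈ I) : 0 ≤ deriv f x := by
  rw [← derivWithin_of_mem_nhds (hI.mem_nhds hx)]
  exact hf.monotoneOn.derivWithin_nonneg

theorem IsOpen.exists_mem_lt {I : Set ℝ} (hI : IsOpen I) {x : ℝ} (hx : x ∈ I) :
    ∃ y ∈ I, y < x := by
  obtain ⟨l, r, hlr, hsub⟩ := (mem_nhds_iff_exists_Ioo_subset).1 (hI.mem_nhds hx)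
  obtain ⟨c, hc⟩ := exists_between hlr.1
  exact ⟨c, hsub ⟨hc.1, hc.2.trans hlr.2⟩, hc.2⟩

theorem IsOpen.exists_mem_gt {I : Set ℝ} (hI : IsOpen I) {x : ℝ} (hx : x ∈ I) :
    ∃ y ∈ I, x < y := by
  obtain ⟨l, r, hlr, hsub⟩ := (mem_nhds_iff_exists_Ioo_subset).1 (hI.mem_nhds hx)
  obtain ⟨c, hc⟩ := exists_between hlr.2
  exact ⟨c, hsub ⟨hlr.1.trans hc.1, hc.2⟩, hc.1⟩

/-- If `g * w₁` and `g * w₂` are convex and the differentiable weights `w₁`, `w₂` have opposite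
signs at `x`, then `g` is differentiable at `x`: its one-sided derivatives exist, and convexity
forces their difference to have both signs. -/
theorem differentiableAt_of_convexOn_mul {I : Set ℝ} (hI : IsOpen I) {g w₁ w₂ : ℝ → ℝ} {x : ℝ}
    (hx : x ∈ I) (h₁ : ConvexOn ℝ I (fun t => g t * w₁ t)) (h₂ : ConvexOn ℝ I (fun t => g t * w₂ t))
    (hw₁ : DifferentiableAt ℝ w₁ x) (hw₂ : DifferentiableAt ℝ w₂ x) (h₁pos : 0 < w₁ x)
    (h₂neg : w₂ x < 0) : DifferentiableAt ℝ g x := by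
  have hxi : x ∈ interior I := by rwa [hI.interior_eq]
  have hl₁ := h₁.hasDerivWithinAt_leftDeriv_of_mem_interior hxi
  have hr₁ := h₁.hasDerivWithinAt_rightDeriv_of_mem_interior hxi
  have hj₁ := h₁.leftDeriv_le_rightDeriv_of_mem_interior hxi
  have hj₂ := h₂.leftDeriv_le_rightDeriv_of_mem_interior hxi
  have key : ∀ {s : Set ℝ} {d : ℝ}, HasDerivWithinAt (fun t => g t * w₁ t) d s x →
      HasDerivWithinAt g ((d * w₁ x - g x * w₁ x * deriv w₁ x) / w₁ x ^ 2) s x := by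
    intro s d hd
    have := hd.div hw₁.hasDerivAt.hasDerivWithinAt h₁pos.ne'
    refine this.congr_of_eventuallyEq ?_ ?_
    · have : ∀ᶠ t in 𝓝[s] x, w₁ t ≠ 0 :=
        nhdsWithin_le_nhds (hw₁.continuousAt.eventually_ne h₁pos.ne')
      filter_upwards [this] with t ht
      simp [ht]
    · simp [h₁pos.ne']
  have hgl := key hl₁
  have hgr := key hr₁
  set dl := (derivWithin (fun t => g t * w₁ t) (Iio x) x * w₁ x
    - g x * w₁ x * deriv w₁ x) / w₁ x ^ 2 with hdl
  set dr := (derivWithin (fun t => g t * w₁ t) (Ioi x) x * w₁ x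
    - g x * w₁ x * deriv w₁ x) / w₁ x ^ 2 with hdr
  have hle : dl ≤ dr := by
    rw [hdl, hdr]; gcongr
  have hge : dr ≤ dl := by
    have el := (hgl.mul hw₂.hasDerivAt.hasDerivWithinAt).derivWithin (uniqueDiffWithinAt_Iio x)
    have er := (hgr.mul hw₂.hasDerivAt.hasDerivWithinAt).derivWithin (uniqueDiffWithinAt_Ioi x)
    have : dl * w₂ x ≤ dr * w₂ x := by
      have := el ▸ er ▸ hj₂
      linarith
    nlinarith
  have : dl = dr := le_antisymm hle hge
  rw [this] at hgl
  exact (hasDerivAt_of_left_right hgl hgr).differentiableAt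

/-- Subtracting the products for `c = a` and `c = b` leaves a nonzero constant multiple of `g`. -/
theorem contDiffOn_one_of_convexOn_mul {I : Set ℝ} (hI : IsOpen I) {g f : ℝ → ℝ} {a b : ℝ}
    (ha : a ∈ I) (hb : b ∈ I) (hab : f a ≠ f b) (hf : ∀ x ∈ I, DifferentiableAt ℝ f x)
    (hg : ∀ x ∈ I, DifferentiableAt ℝ g x)
    (h : ∀ c ∈ I, ConvexOn ℝ I (fun t => g t * (f t - f c))) : ContDiffOn ℝ 1 g I := by
  have key : ∀ c ∈ I, ContDiffOn ℝ 1 (fun t => g t * (f t - f c)) I := fun c hc =>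
    (h c hc).contDiffOn_one hI fun x hx => (hg x hx).mul ((hf x hx).sub_const _)
  refine (((key a ha).sub (key b hb)).div_const (f b - f a)).congr fun x _ => ?_
  have : f b - f a ≠ 0 := sub_ne_zero.2 hab.symm
  field_simp
  ring

theorem ConvexOn.slice_fst {I : Set ℝ} (hI : Convex ℝ I) {φ : ℝ → ℝ → ℝ}
    (h : ConvexOn ℝ (I ×ˢ I) (fun z : ℝ × ℝ => φ z.1 z.2)) {u : ℝ} (hu : u ∈ I) :
    ConvexOn ℝ I (fun x => φ x u) := by
  refine ⟨hI, fun x hx y hy a b ha hb hab => ?_⟩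
  have := h.2 (x := (x, u)) ⟨hx, hu⟩ (y := (y, u)) ⟨hy, hu⟩ ha hb hab
  simpa [← add_mul, hab] using this

theorem ConvexOn.slice_snd {I : Set ℝ} (hI : Convex ℝ I) {φ : ℝ → ℝ → ℝ}
    (h : ConvexOn ℝ (I ×ˢ I) (fun z : ℝ × ℝ => φ z.1 z.2)) {x : ℝ} (hx : x ∈ I) :
    ConvexOn ℝ I (fun u => φ x u) := by
  refine ⟨hI, fun u hu v hv a b ha hb hab => ?_⟩
  have := h.2 (x := (x, u)) ⟨hx, hu⟩ (y := (x, v)) ⟨hx, hv⟩ ha hb hab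
  simpa [← add_mul, hab] using this

theorem IsCSharp.deriv_pos {k : ℕ} {I : Set ℝ} (hI : IsOpen I) {f : ℝ → ℝ}
    (hm : StrictMonoOn f I) (hf : IsCSharp k I f) {x : ℝ} (hx : x ∈ I) : 0 < deriv f x :=
  (deriv_nonneg_of_strictMonoOn hI hm hx).lt_of_ne' (hf.2 x hx)

/-- Freezing either variable of B gives, up to a positive factor, a convex function `g * (f - f c)`
for every `c`, with `g = p` or `g = -1 / (p f')`. Taking `c` on both sides of a point gives weights
of opposite signs, so both choices of `g` are C¹; `f'` is recovered from them. -/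
theorem StrictMonoOn.regularity_of_convexOn {I : Set ℝ} (hI : IsOpen I) (hc : Convex ℝ I)
    (hne : I.Nonempty) {f p : ℝ → ℝ} (hm : StrictMonoOn f I) (hp_pos : ∀ x ∈ I, 0 < p x)
    (hf : IsCSharp 1 I f)
    (hB : ConvexOn ℝ (I ×ˢ I) (fun z : ℝ × ℝ => bajraktarevicMap f p z.1 z.2)) :
    IsCSharp 2 I f ∧ ContDiffOn ℝ 1 p I := by
  obtain ⟨a, ha⟩ := hne
  obtain ⟨b, hb, hab⟩ := hI.exists_mem_gt ha
  have hfab : f a ≠ f b := (hm ha hb hab).ne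
  have hf' : ∀ x ∈ I, 0 < deriv f x := fun x hx => hf.deriv_pos hI hm hx
  have hd : ∀ x ∈ I, DifferentiableAt ℝ f x := fun x hx =>
    (hf.1.hasDerivAt_of_isOpen hI (by simp) hx).differentiableAt
  have hpc : ∀ u ∈ I, ConvexOn ℝ I (fun x => p x * (f x - f u)) := fun u hu => by
    have hpos : 0 < p u * deriv f u := mul_pos (hp_pos u hu) (hf' u hu)
    refine ((hB.slice_fst hc hu).smul hpos.le).congr fun x _ => ?_
    simp only [bajraktarevicMap, smul_eq_mul]
    exact mul_div_cancel₀ _ hpos.ne'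
  set q : ℝ → ℝ := fun u => -(p u * deriv f u)⁻¹ with hq
  have hqc : ∀ x ∈ I, ConvexOn ℝ I (fun u => q u * (f u - f x)) := fun x hx => by
    refine ((hB.slice_snd hc hx).smul (inv_nonneg.2 (hp_pos x hx).le)).congr fun u _ => ?_
    have := (hp_pos x hx).ne'
    simp only [bajraktarevicMap, smul_eq_mul, hq]
    field_simp
    ring
  have hdiff : ∀ {g : ℝ → ℝ}, (∀ c ∈ I, ConvexOn ℝ I (fun t => g t * (f t - f c))) →
      ContDiffOn ℝ 1 g I := by
    intro g hg
    refine contDiffOn_one_of_convexOn_mul hI ha hb hfab hd (fun x hx => ?_) hg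
    obtain ⟨y, hy, hyx⟩ := hI.exists_mem_lt hx
    obtain ⟨z, hz, hxz⟩ := hI.exists_mem_gt hx
    exact differentiableAt_of_convexOn_mul hI hx (hg y hy) (hg z hz) ((hd x hx).sub_const _)
      ((hd x hx).sub_const _) (sub_pos.2 (hm hy hx hyx)) (sub_neg.2 (hm hx hz hxz))
  have hp1 := hdiff hpc
  have hq1 := hdiff hqc
  have hqp : ∀ x ∈ I, -q x * p x ≠ 0 := fun x hx => by
    have h1 := (hp_pos x hx).ne'
    have h2 := (hf' x hx).ne'
    simp only [hq, neg_neg]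
    positivity
  refine ⟨⟨?_, hf.2⟩, hp1⟩
  rw [show ((2 : ℕ) : WithTop ℕ∞) = 1 + 1 by norm_num, contDiffOn_succ_iff_deriv_of_isOpen hI]
  refine ⟨fun x hx => (hd x hx).differentiableWithinAt, by simp, ?_⟩
  refine ((hq1.neg.mul hp1).inv hqp).congr fun x hx => ?_
  have h1 := (hp_pos x hx).ne'
  have h2 := (hf' x hx).ne'
  simp only [hq, Pi.inv_apply, neg_neg]
  field_simp

/-! ### The mean inequality, and its derivation from convexity -/

theorem add_div_two_mem {I : Set ℝ} (hc : Convex ℝ I) {x y : ℝ} (hx : x ∈ I) (hy : y ∈ I) :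
    (x + y) / 2 ∈ I := by
  have := hc.midpoint_mem hx hy
  rwa [midpoint_eq_smul_add, invOf_eq_inv, smul_eq_mul, inv_mul_eq_div] at this

/-- Jensen convexity of the mean, with the means `u`, `v`, `w` of `x`, `y`, `(x + y) / 2`
characterized by vanishing sums of the deviations `p x * (f x - f u)`. -/
def HasMeanIneq (I : Set ℝ) (f p : ℝ → ℝ) : Prop :=
  ∀ n : ℕ, 1 ≤ n → ∀ x y : Fin n → ℝ, (∀ i, x i ∈ I) → (∀ i, y i ∈ I) → ∀ u ∈ I, ∀ v ∈ I, ∀ w ∈ I,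
    ∑ i, p (x i) * (f (x i) - f u) = 0 → ∑ i, p (y i) * (f (y i) - f v) = 0 →
    ∑ i, p ((x i + y i) / 2) * (f ((x i + y i) / 2) - f w) = 0 → w ≤ (u + v) / 2

theorem HasMeanIneq.neg {I : Set ℝ} {f p : ℝ → ℝ} (h : HasMeanIneq I f p) :
    HasMeanIneq I (-f) p := by
  have key : ∀ (n : ℕ) (x : Fin n → ℝ) (u : ℝ), ∑ i, p (x i) * ((-f) (x i) - (-f) u) = 0 →
      ∑ i, p (x i) * (f (x i) - f u) = 0 := fun n x u hx => by
    rw [← neg_eq_zero, ← Finset.sum_neg_distrib, ← hx]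
    refine Finset.sum_congr rfl fun i _ => ?_
    simp only [Pi.neg_apply]
    ring
  intro n hn x y hx hy u hu v hv w hw h1 h2 h3
  exact h n hn x y hx hy u hu v hv w hw (key n x u h1) (key n y v h2) (key n _ w h3)

/-- The image `f '' I` is an interval, so it contains weighted averages of its points. Thus
`Function.invFunOn` in the mean never returns a junk value. -/
theorem exists_sum_mul_sub_eq_zero {I : Set ℝ} (hc : Convex ℝ I) {f p : ℝ → ℝ}
    (hf : ContinuousOn f I) (hp_pos : ∀ x ∈ I, 0 < p x) {n : ℕ} (hn : 1 ≤ n) {x : Fin n → ℝ}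
    (hx : ∀ i, x i ∈ I) :
    ∃ u ∈ I, f u = (∑ i, p (x i) * f (x i)) / ∑ i, p (x i) := by
  have himg : Convex ℝ (f '' I) := by
    rw [Real.convex_iff_isPreconnected]
    exact hc.isPreconnected.image f hf
  have : Nonempty (Fin n) := ⟨⟨0, hn⟩⟩
  have := himg.centerMass_mem (t := Finset.univ) (w := fun i => p (x i)) (z := fun i => f (x i))
    (fun i _ => (hp_pos _ (hx i)).le)
    (Finset.sum_pos (fun i _ => hp_pos _ (hx i)) Finset.univ_nonempty)
    (fun i _ => mem_image_of_mem f (hx i))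
  obtain ⟨u, hu, h⟩ := this
  refine ⟨u, hu, h.trans ?_⟩
  simp [Finset.centerMass, div_eq_inv_mul]

theorem sum_mul_sub_eq_zero_iff {I : Set ℝ} {f p : ℝ → ℝ}
    (hp_pos : ∀ x ∈ I, 0 < p x) {n : ℕ} (hn : 1 ≤ n) {x : Fin n → ℝ}
    (hx : ∀ i, x i ∈ I) (u : ℝ) :
    ∑ i, p (x i) * (f (x i) - f u) = 0 ↔ f u = (∑ i, p (x i) * f (x i)) / ∑ i, p (x i) := by
  have : Nonempty (Fin n) := ⟨⟨0, hn⟩⟩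
  have hpos : 0 < ∑ i, p (x i) :=
    Finset.sum_pos (fun i _ => hp_pos _ (hx i)) Finset.univ_nonempty
  rw [eq_div_iff hpos.ne']
  simp only [mul_sub, Finset.sum_sub_distrib, ← Finset.sum_mul]
  constructor <;> intro h <;> linarith

theorem isJensenConvexMean_iff {I : Set ℝ} (hc : Convex ℝ I) {f p : ℝ → ℝ}
    (hinj : InjOn f I) (hf : ContinuousOn f I) (hp_pos : ∀ x ∈ I, 0 < p x) :
    IsJensenConvexMean I (bajraktarevicMean I f p) ↔ HasMeanIneq I f p := by
  have hspec : ∀ n : ℕ, 1 ≤ n → ∀ x : Fin n → ℝ, (∀ i, x i ∈ I) →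
      bajraktarevicMean I f p n x ∈ I ∧
        ∑ i, p (x i) * (f (x i) - f (bajraktarevicMean I f p n x)) = 0 := by
    intro n hn x hx
    have h := exists_sum_mul_sub_eq_zero hc hf hp_pos hn hx
    exact ⟨Function.invFunOn_mem h,
      (sum_mul_sub_eq_zero_iff hp_pos hn hx _).2 (Function.invFunOn_eq h)⟩
  have huniq : ∀ n : ℕ, 1 ≤ n → ∀ x : Fin n → ℝ, (∀ i, x i ∈ I) → ∀ u ∈ I,
      ∑ i, p (x i) * (f (x i) - f u) = 0 → bajraktarevicMean I f p n x = u := by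
    intro n hn x hx u hu h
    refine hinj (hspec n hn x hx).1 hu ?_
    rw [(sum_mul_sub_eq_zero_iff hp_pos hn hx _).1 h,
      (sum_mul_sub_eq_zero_iff hp_pos hn hx _).1 (hspec n hn x hx).2]
  have hmid : ∀ n : ℕ, ∀ x y : Fin n → ℝ, (∀ i, x i ∈ I) → (∀ i, y i ∈ I) →
      ∀ i, (x i + y i) / 2 ∈ I := fun n x y hx hy i => add_div_two_mem hc (hx i) (hy i)
  constructor
  · intro h n hn x y hx hy u hu v hv w hw h1 h2 h3
    rw [← huniq n hn x hx u hu h1, ← huniq n hn y hy v hv h2,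
      ← huniq n hn _ (hmid n x y hx hy) w hw h3]
    exact h n hn x y hx hy
  · intro h n hn x y hx hy
    exact h n hn x y hx hy _ (hspec n hn x hx).1 _ (hspec n hn y hy).1 _
      (hspec n hn _ (hmid n x y hx hy)).1 (hspec n hn x hx).2 (hspec n hn y hy).2
      (hspec n hn _ (hmid n x y hx hy)).2

/-- The denominator of B depends only on the second variable, so summing the midpoint inequality
over `i` makes the right side vanish. The deviations of the midpoints from `(u + v) / 2` then have
nonpositive sum, which bounds their mean. -/
theorem hasMeanIneq_of_convexOn {I : Set ℝ} (hI : IsOpen I) (hc : Convex ℝ I) {f p : ℝ → ℝ}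
    (hm : StrictMonoOn f I) (hp_pos : ∀ x ∈ I, 0 < p x) (hf : IsCSharp 1 I f)
    (hB : ConvexOn ℝ (I ×ˢ I) (fun z : ℝ × ℝ => bajraktarevicMap f p z.1 z.2)) :
    HasMeanIneq I f p := by
  intro n hn x y hx hy u hu v hv w hw h1 h2 h3
  have hg : ∀ u ∈ I, 0 < p u * deriv f u := fun u hu =>
    mul_pos (hp_pos u hu) (hf.deriv_pos hI hm hu)
  have hm' := add_div_two_mem hc hu hv
  have key : ∑ i, bajraktarevicMap f p ((x i + y i) / 2) ((u + v) / 2) ≤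
      ∑ i, ((1 / 2) * bajraktarevicMap f p (x i) u + (1 / 2) * bajraktarevicMap f p (y i) v) := by
    refine Finset.sum_le_sum fun i _ => ?_
    have := hB.2 (x := (x i, u)) ⟨hx i, hu⟩ (y := (y i, v)) ⟨hy i, hv⟩
      (by norm_num : (0 : ℝ) ≤ 1 / 2) (by norm_num : (0 : ℝ) ≤ 1 / 2) (by norm_num)
    simp only [Prod.smul_mk, Prod.mk_add_mk, smul_eq_mul] at this
    convert this using 2 <;> ring
  simp only [bajraktarevicMap, Finset.sum_add_distrib, ← Finset.mul_sum, ← Finset.sum_div, h1, h2,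
    zero_div, mul_zero, add_zero] at key
  have hle : ∑ i, p ((x i + y i) / 2) * (f ((x i + y i) / 2) - f ((u + v) / 2)) ≤ 0 := by
    have := (div_le_iff₀ (hg _ hm')).1 key
    simpa using this
  have : Nonempty (Fin n) := ⟨⟨0, hn⟩⟩
  have hpos : 0 < ∑ i, p ((x i + y i) / 2) :=
    Finset.sum_pos (fun i _ => hp_pos _ (add_div_two_mem hc (hx i) (hy i))) Finset.univ_nonempty
  simp only [mul_sub, Finset.sum_sub_distrib, ← Finset.sum_mul] at hle h3
  refine (hm.le_iff_le hw hm').1 ?_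
  refine le_of_mul_le_mul_left (a := ∑ i, p ((x i + y i) / 2)) ?_ hpos
  linarith

/-! ### Deviations, weighted sums and separation -/

/-- The deviation `p x * (f x - f u)` of `x` from `u`. -/
def deviation (f p : ℝ → ℝ) (x u : ℝ) : ℝ := p x * (f x - f u)

theorem HasMeanIneq.sum_deviation_nonpos {I : Set ℝ} (hc : Convex ℝ I) {f p : ℝ → ℝ}
    (hm : StrictMonoOn f I) (hf : ContinuousOn f I) (hp_pos : ∀ x ∈ I, 0 < p x)
    (h : HasMeanIneq I f p) {n : ℕ} {x y : Fin n → ℝ} (hx : ∀ i, x i ∈ I) (hy : ∀ i, y i ∈ I)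
    {u v : ℝ} (hu : u ∈ I) (hv : v ∈ I) (h1 : ∑ i, deviation f p (x i) u ≤ 0)
    (h2 : ∑ i, deviation f p (y i) v ≤ 0) :
    ∑ i, deviation f p ((x i + y i) / 2) ((u + v) / 2) ≤ 0 := by
  rcases Nat.eq_zero_or_pos n with rfl | hn
  · simp
  have hxy : ∀ i, (x i + y i) / 2 ∈ I := fun i => add_div_two_mem hc (hx i) (hy i)
  have hex : ∀ {z : Fin n → ℝ}, (∀ i, z i ∈ I) → ∃ w ∈ I, ∑ i, p (z i) * (f (z i) - f w) = 0 ∧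
      ∀ c ∈ I, (∑ i, deviation f p (z i) c ≤ 0 ↔ w ≤ c) := by
    intro z hz
    obtain ⟨w, hw, hwe⟩ := exists_sum_mul_sub_eq_zero hc hf hp_pos hn hz
    have hw0 := (sum_mul_sub_eq_zero_iff hp_pos hn hz w).2 hwe
    refine ⟨w, hw, hw0, fun c hc => ?_⟩
    have : Nonempty (Fin n) := ⟨⟨0, hn⟩⟩
    have hpos : 0 < ∑ i, p (z i) :=
      Finset.sum_pos (fun i _ => hp_pos _ (hz i)) Finset.univ_nonempty
    rw [← hm.le_iff_le hw hc, ← mul_le_mul_iff_right₀ hpos (b := f w)]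
    simp only [deviation, mul_sub, Finset.sum_sub_distrib, ← Finset.sum_mul] at hw0 ⊢
    constructor <;> intro h <;> linarith
  obtain ⟨a, ha, ha0, hac⟩ := hex hx
  obtain ⟨b, hb, hb0, hbc⟩ := hex hy
  obtain ⟨w, hw, hw0, hwc⟩ := hex hxy
  rw [hwc _ (add_div_two_mem hc hu hv)]
  have := h n hn x y hx hy a ha b hb w hw ha0 hb0 hw0
  linarith [(hac u hu).1 h1, (hbc v hv).1 h2]

/-- Natural weights are realized by listing the `i`-th pair `k i` times. -/
theorem HasMeanIneq.sum_nat_mul_deviation_nonpos {I : Set ℝ} (hc : Convex ℝ I) {f p : ℝ → ℝ}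
    (hm : StrictMonoOn f I) (hf : ContinuousOn f I) (hp_pos : ∀ x ∈ I, 0 < p x)
    (h : HasMeanIneq I f p) {ι : Type*} [Fintype ι] {x y : ι → ℝ} (k : ι → ℕ)
    (hx : ∀ i, x i ∈ I) (hy : ∀ i, y i ∈ I)
    {u v : ℝ} (hu : u ∈ I) (hv : v ∈ I) (h1 : ∑ i, k i * deviation f p (x i) u ≤ 0)
    (h2 : ∑ i, k i * deviation f p (y i) v ≤ 0) :
    ∑ i, k i * deviation f p ((x i + y i) / 2) ((u + v) / 2) ≤ 0 := by
  let e := (Fintype.equivFin (Σ i, Fin (k i))).symm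
  have key : ∀ g : ι → ℝ, ∑ j, g (e j).1 = ∑ i, k i * g i := fun g => by
    rw [e.sum_comp (fun j : Σ i, Fin (k i) => g j.1), Fintype.sum_sigma]
    simp
  rw [← key] at h1 h2 ⊢
  exact h.sum_deviation_nonpos hc hm hf hp_pos (fun j => hx _) (fun j => hy _) hu hv h1 h2

/-- Real weights are limits of `⌊w i * N⌋₊ / N`. The strict hypotheses persist for large `N`; only a
weak inequality survives the limit. -/
theorem HasMeanIneq.sum_mul_deviation_nonpos {I : Set ℝ} (hc : Convex ℝ I) {f p : ℝ → ℝ}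
    (hm : StrictMonoOn f I) (hf : ContinuousOn f I) (hp_pos : ∀ x ∈ I, 0 < p x)
    (h : HasMeanIneq I f p) {ι : Type*} [Fintype ι] {x y : ι → ℝ} {w : ι → ℝ} (hw : ∀ i, 0 ≤ w i)
    (hx : ∀ i, x i ∈ I) (hy : ∀ i, y i ∈ I)
    {u v : ℝ} (hu : u ∈ I) (hv : v ∈ I) (h1 : ∑ i, w i * deviation f p (x i) u < 0)
    (h2 : ∑ i, w i * deviation f p (y i) v < 0) :
    ∑ i, w i * deviation f p ((x i + y i) / 2) ((u + v) / 2) ≤ 0 := by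
  have hlim : ∀ g : ι → ℝ, Tendsto (fun N : ℝ => ∑ i, (⌊w i * N⌋₊ / N : ℝ) * g i) atTop
      (𝓝 (∑ i, w i * g i)) := fun g =>
    tendsto_finsetSum _ fun i _ => (tendsto_nat_floor_mul_div_atTop (hw i)).mul_const _
  refine le_of_tendsto (hlim _) ?_
  filter_upwards [(hlim _).eventually_lt_const h1, (hlim _).eventually_lt_const h2,
    eventually_gt_atTop 0] with N hN1 hN2 hN
  have hfac : ∀ g : ι → ℝ, ∑ i, (⌊w i * N⌋₊ / N : ℝ) * g i
      = (∑ i, (⌊w i * N⌋₊ : ℝ) * g i) / N := fun g => by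
    rw [Finset.sum_div]
    exact Finset.sum_congr rfl fun i _ => by ring
  rw [hfac] at hN1 hN2 ⊢
  refine div_nonpos_of_nonpos_of_nonneg ?_ hN.le
  refine h.sum_nat_mul_deviation_nonpos hc hm hf hp_pos _ hx hy hu hv ?_ ?_
  · simpa using ((div_lt_iff₀ hN).1 hN1).le
  · simpa using ((div_lt_iff₀ hN).1 hN2).le

/-- Separation of a set in `ℝ³` from the open octant `s < 0`, `t < 0`, `0 < r`. -/
theorem exists_separation {S : Set (ℝ × ℝ × ℝ)} (hS : S.Nonempty)
    (h : ∀ z ∈ convexHull ℝ S, z.1 < 0 → z.2.1 < 0 → z.2.2 ≤ 0) :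
    ∃ α β γ : ℝ, 0 ≤ α ∧ 0 ≤ β ∧ 0 ≤ γ ∧ (α ≠ 0 ∨ β ≠ 0 ∨ γ ≠ 0) ∧
      ∀ z ∈ S, γ * z.2.2 ≤ α * z.1 + β * z.2.1 := by
  set Q : Set (ℝ × ℝ × ℝ) := Iio 0 ×ˢ Iio 0 ×ˢ Ioi 0 with hQ
  obtain ⟨φ, c, hφQ, hφS⟩ := geometric_hahn_banach_open (s := Q) (t := convexHull ℝ S)
    ((convex_Iio 0).prod ((convex_Iio 0).prod (convex_Ioi 0)))
    (isOpen_Iio.prod (isOpen_Iio.prod isOpen_Ioi)) (convex_convexHull ℝ S) (by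
      rw [Set.disjoint_left]
      rintro z ⟨h1, h2, h3⟩ hz
      exact absurd (h z hz h1 h2) (not_le.2 h3))
  set α := φ (1, 0, 0) with hα
  set β := φ (0, 1, 0) with hβ
  set γ := φ (0, 0, 1) with hγ
  have hφ : ∀ a b r : ℝ, φ (a, b, r) = a * α + b * β + r * γ := fun a b r => by
    have : ((a, b, r) : ℝ × ℝ × ℝ) = a • (1, 0, 0) + b • (0, 1, 0) + r • (0, 0, 1) := by
      ext <;> simp
    rw [this, map_add, map_add, map_smul, map_smul, map_smul]
    rfl
  have hlt : ∀ a b r : ℝ, a < 0 → b < 0 → 0 < r → a * α + b * β + r * γ < c := fun a b r ha hb hr =>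
    (hφ a b r) ▸ hφQ (a, b, r) ⟨ha, hb, hr⟩
  -- The octant is a cone, so a linear functional bounded above on it is nonpositive there.
  have hle : ∀ a b r : ℝ, a < 0 → b < 0 → 0 < r → a * α + b * β + r * γ ≤ 0 := by
    intro a b r ha hb hr
    by_contra! hpos
    obtain ⟨N, hN⟩ := exists_nat_gt (c / (a * α + b * β + r * γ))
    rw [div_lt_iff₀ hpos] at hN
    have hN0 : (0 : ℝ) < N + 1 := by positivity
    have := hlt ((N + 1) * a) ((N + 1) * b) ((N + 1) * r) (mul_neg_of_pos_of_neg hN0 ha)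
      (mul_neg_of_pos_of_neg hN0 hb) (mul_pos hN0 hr)
    nlinarith
  have hlim : ∀ g : ℝ → ℝ, Continuous g → ∀ d, (∀ ε > 0, g ε ≤ d) → g 0 ≤ d := by
    intro g hg d hd
    have ht : Tendsto g (𝓝[>] 0) (𝓝 (g 0)) :=
      hg.continuousAt.tendsto.mono_left nhdsWithin_le_nhds
    refine le_of_tendsto ht ?_
    filter_upwards [self_mem_nhdsWithin] with ε hε using hd ε hε
  have hc0 : 0 ≤ c := by
    have := hlim (fun ε => (-ε) * α + (-ε) * β + ε * γ) (by fun_prop) c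
      fun ε hε => (hlt _ _ _ (neg_lt_zero.2 hε) (neg_lt_zero.2 hε) hε).le
    simpa using this
  have h1 := hlim (fun ε => (-1) * α + (-ε) * β + ε * γ) (by fun_prop) 0
      fun ε hε => (hle _ _ _ (by norm_num) (neg_lt_zero.2 hε) hε)
  have h2 := hlim (fun ε => (-ε) * α + (-1) * β + ε * γ) (by fun_prop) 0
      fun ε hε => (hle _ _ _ (neg_lt_zero.2 hε) (by norm_num) hε)
  have h3 := hlim (fun ε => (-ε) * α + (-ε) * β + 1 * γ) (by fun_prop) 0
      fun ε hε => (hle _ _ _ (neg_lt_zero.2 hε) (neg_lt_zero.2 hε) (by norm_num))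
  refine ⟨α, β, -γ, by linarith, by linarith, by linarith, ?_, ?_⟩
  -- A zero functional would give both `0 < c` and `c ≤ 0`.
  · by_contra! hcon
    obtain ⟨hα0, hβ0, hγ0⟩ := hcon
    obtain ⟨z, hz⟩ := hS
    have h4 := hφS z (subset_convexHull ℝ S hz)
    have h5 := hlt (-1) (-1) 1 (by norm_num) (by norm_num) (by norm_num)
    have h6 := hφ z.1 z.2.1 z.2.2
    simp only [Prod.mk.eta] at h6
    rw [hα0, hβ0, neg_eq_zero.1 hγ0] at h5 h6
    linarith
  · intro z hz
    have h4 := hφS z (subset_convexHull ℝ S hz)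
    have h6 := hφ z.1 z.2.1 z.2.2
    simp only [Prod.mk.eta] at h6
    linarith

/-- A Lagrange multiplier argument: α and β are the coefficients of the separating functional,
normalized by γ. If γ were 0, testing with `a < u` and `b < v` would kill α and β too. -/
theorem HasMeanIneq.exists_weights {I : Set ℝ} (hI : IsOpen I) (hc : Convex ℝ I) {f p : ℝ → ℝ}
    (hm : StrictMonoOn f I) (hf : ContinuousOn f I) (hp_pos : ∀ x ∈ I, 0 < p x)
    (h : HasMeanIneq I f p) {u v : ℝ} (hu : u ∈ I) (hv : v ∈ I) :
    ∃ α β : ℝ, 0 ≤ α ∧ 0 ≤ β ∧ ∀ a ∈ I, ∀ b ∈ I,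
      deviation f p ((a + b) / 2) ((u + v) / 2) ≤ α * deviation f p a u + β * deviation f p b v := by
  set S : Set (ℝ × ℝ × ℝ) := (fun z : ℝ × ℝ => (deviation f p z.1 u, deviation f p z.2 v,
    deviation f p ((z.1 + z.2) / 2) ((u + v) / 2))) '' (I ×ˢ I) with hS
  have hneg : ∀ {a u : ℝ}, a ∈ I → u ∈ I → a < u → deviation f p a u < 0 := fun ha hu hau =>
    mul_neg_of_pos_of_neg (hp_pos _ ha) (sub_neg.2 (hm ha hu hau))
  obtain ⟨α, β, γ, hα, hβ, hγ, hne, hle⟩ := exists_separation (S := S)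
    ⟨_, mem_image_of_mem _ (mk_mem_prod hu hv)⟩ (by
      intro z hz h1 h2
      rw [mem_convexHull_iff_exists_fintype] at hz
      obtain ⟨ι, _, w, s, hw, -, hs, rfl⟩ := hz
      choose q hq hqs using hs
      simp only [← hqs, Prod.fst_sum, Prod.snd_sum, Prod.smul_mk, smul_eq_mul] at h1 h2 ⊢
      exact h.sum_mul_deviation_nonpos hc hm hf hp_pos hw (fun i => (hq i).1) (fun i => (hq i).2)
        hu hv h1 h2)
  have hle' : ∀ a ∈ I, ∀ b ∈ I, γ * deviation f p ((a + b) / 2) ((u + v) / 2) ≤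
      α * deviation f p a u + β * deviation f p b v := fun a ha b hb =>
    hle _ (mem_image_of_mem _ (mk_mem_prod ha hb))
  have hγ0 : γ ≠ 0 := by
    rintro rfl
    obtain ⟨a, ha, hau⟩ := hI.exists_mem_lt hu
    obtain ⟨b, hb, hbv⟩ := hI.exists_mem_lt hv
    have h1 := hneg ha hu hau
    have h2 := hneg hb hv hbv
    have h3 := hle' a ha b hb
    have h4 := mul_nonpos_of_nonneg_of_nonpos hα h1.le
    have h5 := mul_nonpos_of_nonneg_of_nonpos hβ h2.le
    have h6 : α * deviation f p a u = 0 := by linarith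
    have h7 : β * deviation f p b v = 0 := by linarith
    have := (mul_eq_zero.1 h6).resolve_right h1.ne
    have := (mul_eq_zero.1 h7).resolve_right h2.ne
    simp_all
  have hγpos := hγ.lt_of_ne' hγ0
  refine ⟨α / γ, β / γ, by positivity, by positivity, fun a ha b hb => ?_⟩
  rw [div_mul_eq_mul_div, div_mul_eq_mul_div, ← add_div, le_div_iff₀ hγpos, mul_comm]
  exact hle' a ha b hb

/-! ### Convexity of the deviation and differentiability of `f` -/

theorem deviation_neg {I : Set ℝ} {f p : ℝ → ℝ} (hm : StrictMonoOn f I)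
    (hp_pos : ∀ x ∈ I, 0 < p x) {a u : ℝ} (ha : a ∈ I) (hu : u ∈ I) (hau : a < u) :
    deviation f p a u < 0 :=
  mul_neg_of_pos_of_neg (hp_pos _ ha) (sub_neg.2 (hm ha hu hau))

theorem deviation_pos {I : Set ℝ} {f p : ℝ → ℝ} (hm : StrictMonoOn f I)
    (hp_pos : ∀ x ∈ I, 0 < p x) {a u : ℝ} (ha : a ∈ I) (hu : u ∈ I) (hua : u < a) :
    0 < deviation f p a u :=
  mul_pos (hp_pos _ ha) (sub_pos.2 (hm hu ha hua))

theorem deviation_self (f p : ℝ → ℝ) (u : ℝ) : deviation f p u u = 0 := by simp [deviation]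

theorem HasMeanIneq.deviation_midpoint_le {I : Set ℝ} (hI : IsOpen I) (hc : Convex ℝ I)
    {f p : ℝ → ℝ} (hm : StrictMonoOn f I) (hf : ContinuousOn f I) (hp_pos : ∀ x ∈ I, 0 < p x)
    (h : HasMeanIneq I f p) {u a b : ℝ} (hu : u ∈ I) (ha : a ∈ I) (hb : b ∈ I) :
    deviation f p ((a + b) / 2) u ≤ (deviation f p a u + deviation f p b u) / 2 := by
  obtain ⟨α, β, -, -, hle⟩ := h.exists_weights hI hc hm hf hp_pos hu hu
  simp only [add_self_div_two] at hle
  obtain ⟨y, hy, hyu⟩ := hI.exists_mem_lt hu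
  obtain ⟨z, hz, huz⟩ := hI.exists_mem_gt hu
  have h1 := hle y hy y hy
  have h2 := hle z hz z hz
  rw [add_self_div_two, ← add_mul] at h1 h2
  have hyneg := deviation_neg hm hp_pos hy hu hyu
  have hzpos := deviation_pos hm hp_pos hz hu huz
  -- A negative deviation on the diagonal gives `α + β ≤ 1`, a positive one the reverse. Averaging
  -- over the swap of `a` and `b` then replaces both weights by 1/2.
  have h3 : α + β = 1 := le_antisymm (by nlinarith) (by nlinarith)
  have h4 := hle a ha b hb
  have h5 := hle b hb a ha
  rw [add_comm b a] at h5
  obtain rfl : β = 1 - α := by linarith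
  nlinarith

/-- Bernstein–Doetsch needs an upper bound, but `p` is not yet known to be locally bounded. To the
left of its base point a deviation is negative, so there it is convex and continuous. A base point
`c` beyond the segment thus bounds `p` on the segment, and with it the deviation from any `u`. -/
theorem HasMeanIneq.convexOn_deviation {I : Set ℝ} (hI : IsOpen I) (hc : Convex ℝ I)
    {f p : ℝ → ℝ} (hm : StrictMonoOn f I) (hf : ContinuousOn f I) (hp_pos : ∀ x ∈ I, 0 < p x)
    (h : HasMeanIneq I f p) {u : ℝ} (hu : u ∈ I) :
    ConvexOn ℝ I (fun x => deviation f p x u) := by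
  have hmid : ∀ u ∈ I, ∀ x ∈ I, ∀ y ∈ I, deviation f p ((1 / 2 : ℝ) • (x + y)) u ≤
      (deviation f p x u + deviation f p y u) / 2 := fun u hu x hx y hy => by
    rw [show (1 / 2 : ℝ) • (x + y) = (x + y) / 2 by rw [smul_eq_mul]; ring]
    exact h.deviation_midpoint_le hI hc hm hf hp_pos hu hx hy
  have hleft : ∀ u ∈ I, ConvexOn ℝ (I ∩ Iio u) (fun x => deviation f p x u) := fun u hu => by
    have hcv : Convex ℝ (I ∩ Iio u) := hc.inter (convex_Iio u)
    refine convexOn_of_midpoint_le hcv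
      (fun x hx y hy => hmid u hu x hx.1 y hy.1) fun x hx y hy => ⟨0, fun t ht => ?_⟩
    have := hcv hx hy (by linarith [ht.2]) ht.1 (by ring : 1 - t + t = 1)
    exact (deviation_neg hm hp_pos this.1 hu this.2).le
  refine convexOn_of_midpoint_le hc (hmid u hu) fun x hx y hy => ?_
  have hcI : max x y ∈ I := by rcases max_choice x y with h | h <;> rw [h] <;> assumption
  obtain ⟨c, hcc, hlt⟩ := hI.exists_mem_gt hcI
  have hmem : ∀ t ∈ Icc (0 : ℝ) 1, (1 - t) • x + t • y ∈ I ∩ Iic (max x y) := fun t ht =>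
    (hc.inter (convex_Iic _)) ⟨hx, le_max_left x y⟩ ⟨hy, le_max_right x y⟩
      (by linarith [ht.2]) ht.1 (by ring)
  have hcont : ContinuousOn (fun t : ℝ => deviation f p ((1 - t) • x + t • y) c) (Icc 0 1) :=
    ((hleft c hcc).continuousOn (hI.inter isOpen_Iio)).comp (by fun_prop)
      fun t ht => ⟨(hmem t ht).1, (hmem t ht).2.trans_lt hlt⟩
  obtain ⟨M, hM⟩ := (isCompact_Icc.image_of_continuousOn hcont).bddBelow
  have hpos : 0 < f c - f (max x y) := sub_pos.2 (hm hcI hcc hlt)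
  refine ⟨-M / (f c - f (max x y)) * |f (max x y) - f u|, fun t ht => ?_⟩
  have h1 := hM (mem_image_of_mem _ ht)
  obtain ⟨h2, h3⟩ := hmem t ht
  set z := (1 - t) • x + t • y
  have h4 : f z ≤ f (max x y) := hm.monotoneOn h2 hcI h3
  have hpz := hp_pos z h2
  have h5 : p z ≤ -M / (f c - f (max x y)) := by
    rw [le_div_iff₀ hpos]
    simp only [deviation] at h1
    nlinarith
  calc p z * (f z - f u) ≤ p z * |f (max x y) - f u| :=
        mul_le_mul_of_nonneg_left (le_trans (by linarith) (le_abs_self _)) hpz.le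
    _ ≤ _ := mul_le_mul_of_nonneg_right h5 (abs_nonneg _)

theorem HasMeanIneq.continuousOn_weight {I : Set ℝ} (hI : IsOpen I) (hc : Convex ℝ I)
    {f p : ℝ → ℝ} (hm : StrictMonoOn f I) (hf : ContinuousOn f I) (hp_pos : ∀ x ∈ I, 0 < p x)
    (h : HasMeanIneq I f p) : ContinuousOn p I := by
  intro u hu
  obtain ⟨v, hv, huv⟩ := hI.exists_mem_gt hu
  have key : ∀ c ∈ I, ContinuousOn (fun x => deviation f p x c) I := fun c hcI =>
    (h.convexOn_deviation hI hc hm hf hp_pos hcI).continuousOn hI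
  have hne : f v - f u ≠ 0 := (sub_pos.2 (hm hu hv huv)).ne'
  refine (((key u hu).sub (key v hv)).div_const (f v - f u)).congr (fun x _ => ?_) u hu
  simp only [deviation, Pi.sub_apply]
  field_simp
  ring

/-- The slope of the deviation at its base point is `p x` times the slope of `f`, so continuity of
`p` is enough. -/
theorem hasDerivAt_deviation {f p : ℝ → ℝ} {u d : ℝ} (hf : HasDerivAt f d u)
    (hp : ContinuousAt p u) : HasDerivAt (fun x => deviation f p x u) (p u * d) u := by
  rw [hasDerivAt_iff_tendsto_slope] at hf ⊢
  refine ((hp.tendsto.mono_left nhdsWithin_le_nhds).mul hf).congr fun x => ?_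
  rw [slope_def_field, slope_def_field]
  simp only [deviation, sub_self, mul_zero, sub_zero]
  ring

theorem hasDerivAt_of_deviation {f p : ℝ → ℝ} {u d : ℝ}
    (h : HasDerivAt (fun x => deviation f p x u) d u) (hp : ContinuousAt p u) (hpu : p u ≠ 0) :
    HasDerivAt f (d / p u) u := by
  rw [hasDerivAt_iff_tendsto_slope] at h ⊢
  refine (h.div (hp.tendsto.mono_left nhdsWithin_le_nhds) hpu).congr' ?_
  have : ∀ᶠ x in 𝓝[≠] u, p x ≠ 0 := nhdsWithin_le_nhds (hp.eventually_ne hpu)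
  filter_upwards [this] with x hx
  rw [Pi.div_apply, slope_def_field, slope_def_field]
  simp only [deviation, sub_self, mul_zero, sub_zero]
  field_simp

theorem StrictMonoOn.exists_differentiableAt {I U : Set ℝ} (hI : IsOpen I) {f : ℝ → ℝ}
    (hm : StrictMonoOn f I) (hU : IsOpen U) (hUI : U ⊆ I) (hne : U.Nonempty) :
    ∃ u ∈ U, DifferentiableAt ℝ f u := by
  by_contra! hcon
  have h0 : MeasureTheory.volume U = 0 := by
    refine MeasureTheory.measure_mono_null (fun x hx => ?_)
      (MeasureTheory.ae_iff.1 hm.monotoneOn.ae_differentiableWithinAt_of_mem)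
    simp only [mem_ofPred_eq, Classical.not_imp]
    exact ⟨hUI hx, fun hd => hcon x hx (hd.differentiableAt (hI.mem_nhds (hUI hx)))⟩
  exact (hU.measure_pos MeasureTheory.volume hne).ne' h0

/-- Convexity gives one-sided derivatives `L m ≤ R m`. Choose `u` near `m` where `f` is
differentiable and let `v = 2 * m - u`. With `b = v`, the weighted inequality is an equality at `a =
u`; comparing one-sided derivatives yields `R m / 2 ≤ α * R u = α * L u ≤ L m / 2`. -/
theorem HasMeanIneq.exists_hasDerivAt {I : Set ℝ} (hI : IsOpen I) (hc : Convex ℝ I)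
    {f p : ℝ → ℝ} (hm : StrictMonoOn f I) (hf : ContinuousOn f I) (hp_pos : ∀ x ∈ I, 0 < p x)
    (h : HasMeanIneq I f p) {m : ℝ} (hmI : m ∈ I) :
    ∃ d, 0 < d ∧ HasDerivAt (fun x => deviation f p x m) d m := by
  have hconv := fun u hu => h.convexOn_deviation hI hc hm hf hp_pos (u := u) hu
  have hpc := h.continuousOn_weight hI hc hm hf hp_pos
  have hint : ∀ {x}, x ∈ I → x ∈ interior I := fun hx => by rwa [hI.interior_eq]
  have hL := fun u hu => (hconv u hu).hasDerivWithinAt_leftDeriv_of_mem_interior (hint hu)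
  have hR := fun u hu => (hconv u hu).hasDerivWithinAt_rightDeriv_of_mem_interior (hint hu)
  have hLR := fun u hu => (hconv u hu).leftDeriv_le_rightDeriv_of_mem_interior (hint hu)
  set L : ℝ → ℝ := fun u => derivWithin (fun x => deviation f p x u) (Iio u) u with hLdef
  set R : ℝ → ℝ := fun u => derivWithin (fun x => deviation f p x u) (Ioi u) u with hRdef
  have hLpos : ∀ u ∈ I, 0 < L u := fun u hu => by
    obtain ⟨a, ha, hau⟩ := hI.exists_mem_lt hu
    refine lt_of_lt_of_le ?_ ((hconv u hu).slope_le_leftDeriv_of_mem_interior ha (hint hu) hau)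
    rw [slope_def_field, deviation_self]
    exact div_pos (by linarith [deviation_neg hm hp_pos ha hu hau]) (by linarith)
  obtain ⟨u, ⟨hu, hv⟩, hdu⟩ := hm.exists_differentiableAt hI
    (U := I ∩ (fun u => 2 * m - u) ⁻¹' I) (hI.inter (hI.preimage (by fun_prop)))
    inter_subset_left ⟨m, hmI, by simpa [two_mul] using hmI⟩
  rw [mem_preimage] at hv
  have hdev := hasDerivAt_deviation hdu.hasDerivAt (hpc.continuousAt (hI.mem_nhds hu))
  have hLRu : L u = R u := by
    rw [hLdef, hRdef]
    simp only
    rw [hdev.hasDerivWithinAt.derivWithin (uniqueDiffWithinAt_Iio u),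
      hdev.hasDerivWithinAt.derivWithin (uniqueDiffWithinAt_Ioi u)]
  obtain ⟨α, β, hα, -, hle⟩ := h.exists_weights hI hc hm hf hp_pos hu hv
  have hle' : ∀ x ∈ I, deviation f p ((x + (2 * m - u)) / 2) m ≤ α * deviation f p x u := by
    intro x hx
    have := hle x hx _ hv
    rwa [deviation_self, mul_zero, add_zero, show (u + (2 * m - u)) / 2 = m by ring] at this
  have hmu : (u + (2 * m - u)) / 2 = m := by ring
  have hin : ∀ s, HasDerivWithinAt (fun x : ℝ => (x + (2 * m - u)) / 2) (1 / 2) s u := fun s =>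
    (((hasDerivAt_id u).add_const (2 * m - u)).div_const 2).hasDerivWithinAt
  have h1 : HasDerivWithinAt (fun x => deviation f p ((x + (2 * m - u)) / 2) m) (R m * (1 / 2))
      (Ioi u) u := by
    refine HasDerivWithinAt.comp (h₂ := fun x => deviation f p x m)
      (h := fun x : ℝ => (x + (2 * m - u)) / 2) (s' := Ioi m) u ?_ (hin _) ?_
    · rw [hmu]; exact hR m hmI
    · intro x hx
      simp only [mem_Ioi] at hx ⊢
      linarith
  have h2 : HasDerivWithinAt (fun x => deviation f p ((x + (2 * m - u)) / 2) m) (L m * (1 / 2))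
      (Iio u) u := by
    refine HasDerivWithinAt.comp (h₂ := fun x => deviation f p x m)
      (h := fun x : ℝ => (x + (2 * m - u)) / 2) (s' := Iio m) u ?_ (hin _) ?_
    · rw [hmu]; exact hL m hmI
    · intro x hx
      simp only [mem_Iio] at hx ⊢
      linarith
  have heq : deviation f p ((u + (2 * m - u)) / 2) m = α * deviation f p u u := by
    rw [hmu, deviation_self, deviation_self, mul_zero]
  have h3 := right_deriv_le_of_le h1 ((hR u hu).const_mul α) heq
    (nhdsWithin_le_nhds (eventually_of_mem (hI.mem_nhds hu) hle'))
  have h4 := left_deriv_le_of_le h2 ((hL u hu).const_mul α) heq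
    (nhdsWithin_le_nhds (eventually_of_mem (hI.mem_nhds hu) hle'))
  have h5 : L m = R m := by
    refine le_antisymm (hLR m hmI) ?_
    change R m * (1 / 2) ≤ α * R u at h3
    change α * L u ≤ L m * (1 / 2) at h4
    rw [hLRu] at h4
    linarith
  refine ⟨L m, hLpos m hmI, hasDerivAt_of_left_right (hL m hmI) ?_⟩
  rw [h5]
  exact hR m hmI

theorem HasMeanIneq.hasDerivAt_deviation {I : Set ℝ} (hI : IsOpen I) (hc : Convex ℝ I)
    {f p : ℝ → ℝ} (hm : StrictMonoOn f I) (hf : ContinuousOn f I) (hp_pos : ∀ x ∈ I, 0 < p x)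
    (h : HasMeanIneq I f p) {u : ℝ} (hu : u ∈ I) :
    DifferentiableAt ℝ f u ∧ 0 < p u * deriv f u ∧
      HasDerivAt (fun x => deviation f p x u) (p u * deriv f u) u := by
  obtain ⟨d, hd, hdev⟩ := h.exists_hasDerivAt hI hc hm hf hp_pos hu
  have hpu := (hp_pos u hu).ne'
  have hfd := hasDerivAt_of_deviation hdev
    ((h.continuousOn_weight hI hc hm hf hp_pos).continuousAt (hI.mem_nhds hu)) hpu
  have : p u * deriv f u = d := by rw [hfd.deriv, mul_div_cancel₀ _ hpu]
  rw [this]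
  exact ⟨hfd.differentiableAt, hd, hdev⟩

/-! ### Convexity of the two-variable map -/

theorem HasMeanIneq.bajraktarevicMap_midpoint_le {I : Set ℝ} (hI : IsOpen I) (hc : Convex ℝ I)
    {f p : ℝ → ℝ} (hm : StrictMonoOn f I) (hf : ContinuousOn f I) (hp_pos : ∀ x ∈ I, 0 < p x)
    (h : HasMeanIneq I f p) {a b u v : ℝ} (ha : a ∈ I) (hb : b ∈ I) (hu : u ∈ I) (hv : v ∈ I) :
    bajraktarevicMap f p ((a + b) / 2) ((u + v) / 2) ≤
      (bajraktarevicMap f p a u + bajraktarevicMap f p b v) / 2 := by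
  have hmI := add_div_two_mem hc hu hv
  obtain ⟨-, hgu, hdu⟩ := h.hasDerivAt_deviation hI hc hm hf hp_pos hu
  obtain ⟨-, hgv, hdv⟩ := h.hasDerivAt_deviation hI hc hm hf hp_pos hv
  obtain ⟨-, hgm, hdm⟩ := h.hasDerivAt_deviation hI hc hm hf hp_pos hmI
  obtain ⟨α, β, -, -, hle⟩ := h.exists_weights hI hc hm hf hp_pos hu hv
  -- With the other entry at its base point, both sides vanish at `x = u`, so their difference has a
  -- minimum there; the first-order condition determines the weight.
  have key : ∀ u v γ : ℝ, u ∈ I → v ∈ I → ∀ gm, HasDerivAt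
        (fun x => deviation f p x ((u + v) / 2)) gm ((u + v) / 2) →
      HasDerivAt (fun x => deviation f p x u) (p u * deriv f u) u →
      (∀ x ∈ I, deviation f p ((x + v) / 2) ((u + v) / 2) ≤ γ * deviation f p x u) →
      γ * (p u * deriv f u) = gm / 2 := by
    intro u v γ hu hv gm hdm hdu hle
    have hin : HasDerivAt (fun x : ℝ => (x + v) / 2) (1 / 2) u :=
      ((hasDerivAt_id u).add_const v).div_const 2
    have h1 := (hdu.const_mul γ).sub (HasDerivAt.comp u
      (h₂ := fun x => deviation f p x ((u + v) / 2)) hdm hin)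
    have hmin : IsLocalMin ((fun x => γ * deviation f p x u) -
        (fun x => deviation f p x ((u + v) / 2)) ∘ fun x : ℝ => (x + v) / 2) u := by
      refine eventually_of_mem (hI.mem_nhds hu) fun x hx => ?_
      simp only [Pi.sub_apply, Function.comp, deviation_self, mul_zero, sub_self]
      linarith [hle x hx]
    linarith [hmin.hasDerivAt_eq_zero h1]
  have hαe := key u v α hu hv _ hdm hdu fun x hx => by
    simpa [deviation_self] using hle x hx v hv
  have hβe := key v u β hv hu (p ((u + v) / 2) * deriv f ((u + v) / 2))
    (by rw [add_comm v u]; exact hdm) hdv fun x hx => by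
    rw [add_comm x u, add_comm v u]
    simpa [deviation_self] using hle u hu x hx
  have h1 := hle a ha b hb
  set gm := p ((u + v) / 2) * deriv f ((u + v) / 2) with hgmd
  have hα : α = gm / 2 / (p u * deriv f u) := by rw [eq_div_iff hgu.ne', hαe]
  have hβ : β = gm / 2 / (p v * deriv f v) := by rw [eq_div_iff hgv.ne', hβe]
  change deviation f p ((a + b) / 2) ((u + v) / 2) / gm ≤
    (deviation f p a u / (p u * deriv f u) + deviation f p b v / (p v * deriv f v)) / 2
  rw [div_le_iff₀ hgm]
  refine h1.trans_eq ?_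
  rw [hα, hβ]
  ring

theorem HasMeanIneq.convexOn_bajraktarevicMap {I : Set ℝ} (hI : IsOpen I) (hc : Convex ℝ I)
    {f p : ℝ → ℝ} (hm : StrictMonoOn f I) (hf : ContinuousOn f I) (hp_pos : ∀ x ∈ I, 0 < p x)
    (h : HasMeanIneq I f p) :
    ConvexOn ℝ (I ×ˢ I) (fun z : ℝ × ℝ => bajraktarevicMap f p z.1 z.2) := by
  refine convexOn_of_midpoint_le (hc.prod hc) ?_ ?_
  · rintro ⟨a, u⟩ ⟨ha, hu⟩ ⟨b, v⟩ ⟨hb, hv⟩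
    have := h.bajraktarevicMap_midpoint_le hI hc hm hf hp_pos ha hb hu hv
    convert this using 2 <;> simp <;> ring
  · rintro ⟨a, u⟩ ⟨ha, hu⟩ ⟨b, v⟩ ⟨hb, hv⟩
    simp only at ha hu hb hv
    have hcI : min u v ∈ I := by rcases min_choice u v with h | h <;> rw [h] <;> assumption
    obtain ⟨c, hcc, hlt⟩ := hI.exists_mem_lt hcI
    have hmem : ∀ x ∈ I, ∀ y ∈ I, MapsTo (fun t : ℝ => (1 - t) * x + t * y) (Icc 0 1) I :=
      fun x hx y hy t ht => hc hx hy (by linarith [ht.2]) ht.1 (by ring)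
    have hU : ∀ t ∈ Icc (0 : ℝ) 1, c < (1 - t) * u + t * v := fun t ht =>
      hlt.trans_le ((convex_Ici (min u v)) (min_le_left u v) (min_le_right u v)
        (by linarith [ht.2]) ht.1 (by ring : 1 - t + t = 1))
    have hpc := h.continuousOn_weight hI hc hm hf hp_pos
    have hcomp : ∀ {g : ℝ → ℝ}, ContinuousOn g I → ∀ x ∈ I, ∀ y ∈ I,
        ContinuousOn (fun t => g ((1 - t) * x + t * y)) (Icc 0 1) := fun hg x hx y hy =>
      hg.comp (by fun_prop) (hmem x hx y hy)
    -- Continuity of `f'` is not available to bound `1 / (p f')`. Convexity of the deviation from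
    -- `w` bounds `p w * deriv f w` below by its slope between `c` and `w`, where `c` lies left of
    -- the segment; the resulting majorant is continuous in `t`.
    have hcont : ContinuousOn (fun t : ℝ => |deviation f p ((1 - t) * a + t * b)
        ((1 - t) * u + t * v)| * ((c - ((1 - t) * u + t * v)) /
          deviation f p c ((1 - t) * u + t * v))) (Icc 0 1) := by
      refine ContinuousOn.mul (ContinuousOn.abs ?_) (ContinuousOn.div (by fun_prop) ?_ ?_)
      · exact (hcomp hpc a ha b hb).mul ((hcomp hf a ha b hb).sub (hcomp hf u hu v hv))
      · exact continuousOn_const.mul (continuousOn_const.sub (hcomp hf u hu v hv))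
      · exact fun t ht => (deviation_neg hm hp_pos hcc (hmem u hu v hv ht) (hU t ht)).ne
    obtain ⟨M, hM⟩ := (isCompact_Icc.image_of_continuousOn hcont).bddAbove
    refine ⟨M, fun t ht => le_trans ?_ (hM (mem_image_of_mem _ ht))⟩
    simp only [Prod.smul_mk, Prod.mk_add_mk, smul_eq_mul]
    have hwI := hmem u hu v hv ht
    have hcw := hU t ht
    simp only at hwI
    set w := (1 - t) * u + t * v
    set z := (1 - t) * a + t * b
    obtain ⟨-, hgw, hdw⟩ := h.hasDerivAt_deviation hI hc hm hf hp_pos hwI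
    have hslope := (h.convexOn_deviation hI hc hm hf hp_pos hwI).slope_le_of_hasDerivAt
      hcc hwI hcw hdw
    have hneg := deviation_neg hm hp_pos hcc hwI hcw
    rw [slope_def_field, deviation_self, zero_sub] at hslope
    change deviation f p z w / (p w * deriv f w) ≤ _
    rw [div_eq_mul_inv]
    refine mul_le_mul (le_abs_self _) ?_ (inv_nonneg.2 hgw.le) (abs_nonneg _)
    refine (inv_anti₀ (div_pos (neg_pos.2 hneg) (sub_pos.2 hcw)) hslope).trans_eq ?_
    rw [inv_div, ← neg_sub w c, neg_div, div_neg]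

/-- For fixed `x > u`, the slice `B(x, ·)` is convex, hence continuous. Solving the formula for B
near `u` expresses `f'` through `f`, `p` and this slice. -/
theorem HasMeanIneq.isCSharp_one {I : Set ℝ} (hI : IsOpen I) (hc : Convex ℝ I)
    {f p : ℝ → ℝ} (hm : StrictMonoOn f I) (hf : ContinuousOn f I) (hp_pos : ∀ x ∈ I, 0 < p x)
    (h : HasMeanIneq I f p) : IsCSharp 1 I f := by
  have hd := fun u hu => h.hasDerivAt_deviation hI hc hm hf hp_pos (u := u) hu
  have hpc := h.continuousOn_weight hI hc hm hf hp_pos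
  refine ⟨?_, fun u hu => (pos_of_mul_pos_right (hd u hu).2.1 (hp_pos u hu).le).ne'⟩
  refine contDiffOn_one_of_deriv hI (fun u hu => (hd u hu).1) fun u hu => ?_
  obtain ⟨x, hx, hux⟩ := hI.exists_mem_gt hu
  have hB := (((h.convexOn_bajraktarevicMap hI hc hm hf hp_pos).slice_snd hc hx).continuousOn hI)
    u hu
  have hBne : p u * bajraktarevicMap f p x u ≠ 0 :=
    (mul_pos (hp_pos u hu) (div_pos (deviation_pos hm hp_pos hx hu hux) (hd u hu).2.1)).ne'
  refine ((((continuousWithinAt_const (b := f x)).sub (hf u hu)).const_mul (p x)).div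
    ((hpc u hu).mul hB) hBne).congr_of_eventuallyEq_of_mem ?_ hu
  have : Iio x ∈ 𝓝[I] u := nhdsWithin_le_nhds (Iio_mem_nhds hux)
  filter_upwards [this, self_mem_nhdsWithin] with v hv hvI
  have h1 := (hp_pos v hvI).ne'
  have h2 := (pos_of_mul_pos_right (hd v hvI).2.1 (hp_pos v hvI).le).ne'
  have h3 := (hp_pos x hx).ne'
  have h4 : f x - f v ≠ 0 := (sub_pos.2 (hm hvI hx hv)).ne'
  simp only [bajraktarevicMap, Pi.div_apply, Pi.mul_apply, Pi.sub_apply]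
  field_simp

/-! ### The equivalence of the four conditions -/

theorem mainTheorem3 (I : Set ℝ) (hI_open : IsOpen I) (hI_interval : I.OrdConnected)
    (hI_nonempty : I.Nonempty) (f p : ℝ → ℝ)
    (hf_mono : StrictMonoOn f I ∨ StrictAntiOn f I) (hf_cont : ContinuousOn f I)
    (hp_pos : ∀ x ∈ I, 0 < p x) :
    List.TFAE [
      IsJensenConvexMean I (bajraktarevicMean I f p),
      IsCSharp 1 I f ∧
        ConvexOn ℝ (I ×ˢ I) (fun z : ℝ × ℝ => bajraktarevicMap f p z.1 z.2),
      IsCSharp 2 I f ∧ ContDiffOn ℝ 1 p I ∧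
        ∀ x ∈ I, ∀ y ∈ I, ∀ u ∈ I, ∀ v ∈ I,
          p y * (f y - f v) / (p v * deriv f v) ≥
            p x * (f x - f u) / (p u * deriv f u)
            + (deriv (fun t => p t * f t) x - f u * deriv p x) / (p u * deriv f u) * (y - x)
            + p x * (((f u - f x) * deriv (fun t => p t * deriv f t) u
                - (p u * deriv f u) * deriv f u) / (p u * deriv f u) ^ 2) * (v - u),
      IsCSharp 2 I f ∧ ContDiffOn ℝ 1 p I ∧
        ∀ x ∈ I, ∀ y ∈ I, ∀ u ∈ I, ∀ v ∈ I,
          ((deriv (fun t => p t * f t) x - f u * deriv p x) / (p u * deriv f u)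
              - (deriv (fun t => p t * f t) y - f v * deriv p y) / (p v * deriv f v)) * (x - y)
            + (p x * (((f u - f x) * deriv (fun t => p t * deriv f t) u
                  - (p u * deriv f u) * deriv f u) / (p u * deriv f u) ^ 2)
              - p y * (((f v - f y) * deriv (fun t => p t * deriv f t) v
                  - (p v * deriv f v) * deriv f v) / (p v * deriv f v) ^ 2)) * (u - v) ≥ 0
    ] := by
  have hc : Convex ℝ I := hI_interval.convex
  have hinj : InjOn f I := hf_mono.elim StrictMonoOn.injOn StrictAntiOn.injOn
  tfae_have 1 ↔ 2 := by
    rw [isJensenConvexMean_iff hc hinj hf_cont hp_pos]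
    rcases hf_mono with hm | hm
    · exact ⟨fun h => ⟨h.isCSharp_one hI_open hc hm hf_cont hp_pos,
        h.convexOn_bajraktarevicMap hI_open hc hm hf_cont hp_pos⟩,
        fun h => hasMeanIneq_of_convexOn hI_open hc hm hp_pos h.1 h.2⟩
    · have hm' : StrictMonoOn (-f) I := hm.neg
      constructor
      · intro h
        refine ⟨?_, ?_⟩
        · simpa using (h.neg.isCSharp_one hI_open hc hm' hf_cont.neg hp_pos).neg
        · rw [← bajraktarevicMap_neg]
          exact h.neg.convexOn_bajraktarevicMap hI_open hc hm' hf_cont.neg hp_pos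
      · intro h
        rw [← bajraktarevicMap_neg] at h
        simpa using (hasMeanIneq_of_convexOn hI_open hc hm' hp_pos h.1.neg h.2).neg
  tfae_have 2 → 3 := by
    intro h
    obtain ⟨hf2, hp1⟩ : IsCSharp 2 I f ∧ ContDiffOn ℝ 1 p I := by
      rcases hf_mono with hm | hm
      · exact hm.regularity_of_convexOn hI_open hc hI_nonempty hp_pos h.1 h.2
      · have hm' : StrictMonoOn (-f) I := hm.neg
        rw [← bajraktarevicMap_neg] at h
        have := hm'.regularity_of_convexOn hI_open hc hI_nonempty hp_pos h.1.neg h.2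
        exact ⟨by simpa using this.1.neg, this.2⟩
    exact ⟨hf2, hp1, fun x hx y hy u hu v hv =>
      (hasPartialsOn_bajraktarevicMap hI_open hc hp_pos hf2 hp1).gradient_le h.2 hx hy hu hv⟩
  tfae_have 3 → 4 := by
    rintro ⟨hf2, hp1, h⟩
    refine ⟨hf2, hp1, fun x hx y hy u hu v hv => ?_⟩
    -- The sum of the tangent plane inequalities in the two directions.
    linarith [h x hx y hy u hu v hv, h y hy x hx v hv u hu]
  tfae_have 4 → 2 := by
    rintro ⟨hf2, hp1, h⟩
    exact ⟨⟨hf2.1.of_le (by norm_num), hf2.2⟩,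
      (hasPartialsOn_bajraktarevicMap hI_open hc hp_pos hf2 hp1).convexOn hc h⟩
  tfae_finish
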